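/- For a spin $j\in\{0,\tfrac12,1,\dots\}$ let $V_j$ be the irreducible representation of $SU(2)$ of dimension $2j+1$. $SU(2)$ spin networks are evaluated in the usual graphical calculus, in which a loop of spin $j$ has the value $(-1)^{2j}(2j+1)$. A triple of spins is admissible if it satisfies the triangle inequality and has an integer sum. For an admissible triple $(j_1,j_2,j_3)$ the trivalent vertex is the $SU(2)$-invariant tensor (unique up to scale) divided by a (complex) square root of the value $\theta(j_1,j_2,j_3)$ that the planar theta graph takes before normalization, so that normalized theta graphs have the value $1$; for other triples the vertex is $0$. The square roots may be chosen arbitrarily. Let $Y_k(j_1,j_2|j_3,j_4)$ denote the tree with four legs $j_1,\dots,j_4$ in which a normalized trivalent vertex with edges $j_1,j_2,k$ is joined by the edge of spin $k$ to a normalized trivalent vertex with edges $k,j_3,j_4$. The modified Barrett–Crane intertwiner for the splitting $\{j_1,j_2\},\{j_3,j_4\}$ of four edges, labelled by the representations $V_{j_i}\otimes V_{j_i}$ of $SU(2)\times SU(2)$, is $$B(j_1,j_2|j_3,j_4)=\sum_k (2k+1)\,Y_k(j_1,j_2|j_3,j_4)\otimes Y_k(j_1,j_2|j_3,j_4),$$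 where the sum is over the spins $k$ for which $(j_1,j_2,k)$ and $(k,j_3,j_4)$ are both admissible. Given ten spins $p_v,q_v$ ($v\in\mathbb Z/5$), consider the complete graph on the vertices $\mathbb Z/5$ of a pentagon, with the side from $v$ to $v+1$ labelled by $V_{p_v}\otimes V_{p_v}$, the diagonal from $v$ to $v+2$ labelled by $V_{q_v}\otimes V_{q_v}$, and the vertex $v$ labelled by the modified Barrett–Crane intertwiner for the cyclic splitting into the two edges from $v-2,v-1$ and the two edges to $v+1,v+2$, that is, by $B(q_{v-2},p_{v-1}|p_v,q_v)$. The modified $10j$ symbol is the value of this closed $SU(2)\times SU(2)$ spin network. **Lemma.** For all ten spins (and all choices of the square roots), the modified $10j$ symbol is a nonnegative real number. -/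

import Mathlib

/-! Spin networks for `SU(2)` and simple spin networks for `SU(2) × SU(2)`.

A spin `j` is given by the natural number `n = 2 j`.  The irreducible representation of `SU(2)` of
spin `j` is the space of binary forms of degree `n`, with the basis `x₀ ^ (n - i) * x₁ ^ i`,
`i : Fin (n + 1)`.  A tensor with several legs is given by its components in these bases. -/

namespace SpinNetwork

open MvPolynomial

noncomputable section

/-- Spins `a / 2`, `b / 2`, `c / 2` form an admissible triple: they satisfy the triangle inequality
and their sum is an integer. -/
def Admissible (a b c : ℕ) : Prop :=
  a ≤ b + c ∧ b ≤ a + c ∧ c ≤ a + b ∧ Even (a + b + c)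

instance (a b c : ℕ) : Decidable (Admissible a b c) := by
  unfold Admissible; infer_instance

/-- The cup joining a strand of leg `u` to a strand of leg `v` (with `u` to the left of `v`): the
`SL(2)`-invariant form `u₀ v₁ - u₁ v₀` in the variables `(u, 0), (u, 1)` and `(v, 0), (v, 1)`. -/
def cup (u v : Fin 3) : MvPolynomial (Fin 3 × Fin 2) ℂ :=
  X (u, 0) * X (v, 1) - X (u, 1) * X (v, 0)

/-- The invariant with three legs of spins `a / 2`, `b / 2`, `c / 2`, before normalization, for an
admissible triple.  The exponents are the numbers of strands running between the legs, and they are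
the natural numbers solving `p + r = a`, `p + q = b`, `q + r = c`. -/
def vertexForm (a b c : ℕ) : MvPolynomial (Fin 3 × Fin 2) ℂ :=
  cup 0 1 ^ ((a + b - c) / 2) * cup 1 2 ^ ((b + c - a) / 2) * cup 0 2 ^ ((a + c - b) / 2)

/-- The exponent of the basis monomial number `i` of binary forms of degree `n` on the leg `l`. -/
def legExponent (l : Fin 3) (n i : ℕ) : Fin 3 × Fin 2 →₀ ℕ :=
  Finsupp.single (l, 0) (n - i) + Finsupp.single (l, 1) i

/-- Components of the trivalent vertex before normalization, with legs `a`, `b`, `c` in this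
(left to right) order; it is zero when the spins are not admissible. -/
def rawVertex (a b c : ℕ) (i : Fin (a + 1)) (j : Fin (b + 1)) (k : Fin (c + 1)) : ℂ :=
  if Admissible a b c then
    (vertexForm a b c).coeff (legExponent 0 a i + legExponent 1 b j + legExponent 2 c k)
  else 0

/-- The cap on two legs of spin `n / 2`, which closes an edge.  It is the invariant bilinear form
on binary forms of degree `n` with `⟪ℓ ^ n, m ^ n⟫ = (ℓ₁ m₀ - ℓ₀ m₁) ^ n` for linear forms
`ℓ = ℓ₀ x₀ + ℓ₁ x₁` and `m = m₀ x₀ + m₁ x₁`.  It is inverse to the cup (the zigzag identity), and a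
closed loop of spin `n / 2` evaluates to `(-1) ^ n * (n + 1)`. -/
def cap (n : ℕ) (i i' : Fin (n + 1)) : ℂ :=
  if (i : ℕ) + (i' : ℕ) = n then (-1) ^ (n - (i : ℕ)) / (n.choose i : ℂ) else 0

/-- The evaluation `θ` of the planar theta graph with vertices that are not normalized: the legs
`a, b, c` of the first vertex are joined by nested caps to the legs `c, b, a` of the second. -/
def theta (a b c : ℕ) : ℂ :=
  ∑ i : Fin (a + 1), ∑ i' : Fin (a + 1), ∑ j : Fin (b + 1), ∑ j' : Fin (b + 1),
    ∑ k : Fin (c + 1), ∑ k' : Fin (c + 1),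
      rawVertex a b c i j k * rawVertex c b a k' j' i' * cap c k k' * cap b j j' * cap a i i'

/-- A choice `r` of a square root of `θ` for every admissible triple.  The square roots are complex
because `θ` may be negative, and each of them is determined up to a sign. -/
def IsThetaRoot (r : ℕ → ℕ → ℕ → ℂ) : Prop :=
  ∀ a b c, Admissible a b c → r a b c ^ 2 = theta a b c

/-- The trivalent vertex, normalized by the square roots `r` of `θ` so that theta graphs evaluate
to `1`. -/
def vertex (r : ℕ → ℕ → ℕ → ℂ) (a b c : ℕ)
    (i : Fin (a + 1)) (j : Fin (b + 1)) (k : Fin (c + 1)) : ℂ :=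
  rawVertex a b c i j k / r a b c

/-- The `SU(2)` network with four legs `a, b, c, d` in which `a, b` and `c, d` are joined through an
edge of spin `k / 2`. -/
def doubleY (r : ℕ → ℕ → ℕ → ℂ) (a b c d k : ℕ)
    (i₁ : Fin (a + 1)) (i₂ : Fin (b + 1)) (i₃ : Fin (c + 1)) (i₄ : Fin (d + 1)) : ℂ :=
  ∑ m : Fin (k + 1), ∑ m' : Fin (k + 1),
    vertex r a b k i₁ i₂ m * cap k m m' * vertex r k c d m' i₃ i₄

/-- Indices of the basis of the simple representation `j ⊗ j` of `SU(2) × SU(2)`, `j = n / 2`. -/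
abbrev SimpleIndex (n : ℕ) : Type := Fin (n + 1) × Fin (n + 1)

/-- The cap for the simple representation `j ⊗ j`, `j = n / 2`. -/
def simpleCap (n : ℕ) (s t : SimpleIndex n) : ℂ :=
  cap n s.1 t.1 * cap n s.2 t.2

/-- The modified Barrett-Crane intertwiner, without signs, for the splitting of the four legs into
the pairs `a, b` and `c, d`: the sum over `k` of `(2 (k / 2) + 1)` times `doubleY ⊗ doubleY`, over
all spins `k / 2` for which the triples `a, b, k` and `c, d, k` are admissible. -/
def modifiedBC (r : ℕ → ℕ → ℕ → ℂ) (a b c d : ℕ)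
    (s₁ : SimpleIndex a) (s₂ : SimpleIndex b) (s₃ : SimpleIndex c) (s₄ : SimpleIndex d) : ℂ :=
  ∑ k ∈ (Finset.range (a + b + 1)).filter (fun k => Admissible a b k ∧ Admissible c d k),
    ((k : ℂ) + 1) *
      (doubleY r a b c d k s₁.1 s₂.1 s₃.1 s₄.1 * doubleY r a b c d k s₁.2 s₂.2 s₃.2 s₄.2)

/-- The modified `10j` symbol.  The network is the complete graph on the vertices `v : Fin 5` (mod
`5`) of a pentagon: the side from `v` to `v + 1` has spin `p v / 2`, and the diagonal from `v` to
`v + 2` has spin `q v / 2`.  At `v` the two edges that come from `v - 2` and `v - 1` are split from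
the two edges that go to `v + 1` and `v + 2`.  The sum is over the indices at the two ends of all
edges: `s`, `s'` at the tails and the heads of sides, `t`, `t'` at the tails and the heads of
diagonals. -/
def modifiedTenJ (r : ℕ → ℕ → ℕ → ℂ) (p q : Fin 5 → ℕ) : ℂ :=
  ∑ s : (∀ v, SimpleIndex (p v)), ∑ s' : (∀ v, SimpleIndex (p v)),
    ∑ t : (∀ v, SimpleIndex (q v)), ∑ t' : (∀ v, SimpleIndex (q v)),
      (∏ v : Fin 5, modifiedBC r (q (v - 2)) (p (v - 1)) (p v) (q v)
        (t' (v - 2)) (s' (v - 1)) (s v) (t v)) *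
      ∏ v : Fin 5, (simpleCap (p v) (s v) (s' v) * simpleCap (q v) (t v) (t' v))

end

end SpinNetwork

namespace SpinNetwork

open MvPolynomial ComplexConjugate

/-! Distributing the sums over `k` and separating the two factors of SU(2) × SU(2) turns the symbol
into a sum, with positive weights, of squares of one SU(2) network (`modifiedTenJ_eq_sum`). Without
normalization this network is real, because vertices and caps have real components. Normalizing
divides its square by ten theta values, so the choice of roots drops out and only the sign of their
product matters. Each theta is `(-1) ^ ((a + b + c) / 2)` times a nonnegative real
(`theta_eq_neg_one_pow_mul`), and the ten signs cancel (`even_sum_pentagon`). -/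

lemma map_conj_vertexForm (a b c : ℕ) :
    MvPolynomial.map (starRingEnd ℂ) (vertexForm a b c) = vertexForm a b c := by
  simp [vertexForm, cup]

lemma conj_rawVertex (a b c : ℕ) (i : Fin (a + 1)) (j : Fin (b + 1)) (k : Fin (c + 1)) :
    conj (rawVertex a b c i j k) = rawVertex a b c i j k := by
  unfold rawVertex
  split_ifs
  · rw [← coeff_map, map_conj_vertexForm]
  · simp

lemma conj_cap (n : ℕ) (i i' : Fin (n + 1)) : conj (cap n i i') = cap n i i' := by
  unfold cap
  split_ifs <;> simp

/-- The involution that reverses the order of the legs and exchanges the two variables of every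
leg. -/
def flip : Fin 3 × Fin 2 ≃ Fin 3 × Fin 2 :=
  Equiv.prodCongr (Equiv.swap 0 2) (Equiv.swap 0 1)

/-- A cup changes sign when its legs are exchanged and again when the variables 0 and 1 are
exchanged; the two signs cancel. -/
lemma rename_flip_vertexForm (a b c : ℕ) :
    rename flip (vertexForm c b a) = vertexForm a b c := by
  have h01 : rename flip (cup 0 1) = cup 1 2 := by
    simp [cup, flip, Equiv.swap_apply_def]; ring
  have h12 : rename flip (cup 1 2) = cup 0 1 := by
    simp [cup, flip, Equiv.swap_apply_def]; ring
  have h02 : rename flip (cup 0 2) = cup 0 2 := by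
    simp [cup, flip]; ring
  simp only [vertexForm, map_mul, map_pow, h01, h12, h02]
  rw [Nat.add_comm c b, Nat.add_comm b a, Nat.add_comm c a]
  ring

lemma Admissible.reverse {a b c : ℕ} (h : Admissible a b c) : Admissible c b a := by
  obtain ⟨h₁, h₂, h₃, h₄⟩ := h
  refine ⟨by omega, by omega, by omega, ?_⟩
  rwa [show c + b + a = a + b + c by ring]

lemma rawVertex_reverse (a b c : ℕ) (i i' : Fin (a + 1)) (j j' : Fin (b + 1))
    (k k' : Fin (c + 1)) (hi : (i : ℕ) + i' = a) (hj : (j : ℕ) + j' = b) (hk : (k : ℕ) + k' = c) :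
    rawVertex c b a k' j' i' = rawVertex a b c i j k := by
  unfold rawVertex
  by_cases h : Admissible a b c
  · rw [if_pos h, if_pos h.reverse, ← rename_flip_vertexForm a b c,
      ← coeff_rename_mapDomain flip flip.injective]
    congr 1
    simp only [legExponent, Finsupp.mapDomain_add, Finsupp.mapDomain_single]
    simp only [flip, Equiv.prodCongr_apply, Prod.map, Equiv.swap_apply_def]
    rw [show c - (k' : ℕ) = k by omega, show b - (j' : ℕ) = j by omega,
      show a - (i' : ℕ) = i by omega, show c - (k : ℕ) = k' by omega,
      show b - (j : ℕ) = j' by omega, show a - (i : ℕ) = i' by omega]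
    simp
    abel
  · rw [if_neg h, if_neg (fun h' => h h'.reverse)]

/-- The weight for which the two variables of a leg have degrees `0` and `1`. -/
def legWeight (x : Fin 3 × Fin 2) : ℕ := x.2

lemma isWeightedHomogeneous_cup (u v : Fin 3) : IsWeightedHomogeneous legWeight (cup u v) 1 := by
  have h (l : Fin 3) (e : Fin 2) :
      IsWeightedHomogeneous legWeight (X (l, e) : MvPolynomial (Fin 3 × Fin 2) ℂ) (e : ℕ) :=
    isWeightedHomogeneous_X ℂ legWeight (l, e)
  exact (weightedHomogeneousSubmodule ℂ legWeight 1).sub_mem ((h u 0).mul (h v 1))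
    ((h u 1).mul (h v 0))

lemma isWeightedHomogeneous_vertexForm (a b c : ℕ) :
    IsWeightedHomogeneous legWeight (vertexForm a b c)
      ((a + b - c) / 2 + (b + c - a) / 2 + (a + c - b) / 2) := by
  have h := (((isWeightedHomogeneous_cup 0 1).pow ((a + b - c) / 2)).mul
    ((isWeightedHomogeneous_cup 1 2).pow ((b + c - a) / 2))).mul
    ((isWeightedHomogeneous_cup 0 2).pow ((a + c - b) / 2))
  simpa [vertexForm] using h

/-- Torus invariance: each of the `(a + b + c) / 2` strands contributes exactly one variable of
index 1. -/
lemma two_mul_add_eq_of_rawVertex_ne_zero {a b c : ℕ} {i : Fin (a + 1)} {j : Fin (b + 1)}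
    {k : Fin (c + 1)} (h : rawVertex a b c i j k ≠ 0) :
    2 * ((i : ℕ) + j + k) = a + b + c := by
  unfold rawVertex at h
  split_ifs at h with hadm
  · have hw := isWeightedHomogeneous_vertexForm a b c h
    simp only [legExponent, map_add, Finsupp.weight_single, legWeight, smul_eq_mul, Fin.val_zero,
      Fin.val_one, mul_zero, mul_one, zero_add] at hw
    obtain ⟨h₁, h₂, h₃, h₄⟩ := hadm
    rw [Nat.even_iff] at h₄
    omega
  · exact absurd rfl h

/-- The caps force complementary indices, where the reversed vertex has the same real component as
the first; so the term is a square over binomials, up to the sign of the caps. By weight, `i + j + k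
= (a + b + c) / 2` in nonzero terms, which makes that sign the same for all of them. -/
lemma theta_term_nonneg (a b c : ℕ) (i i' : Fin (a + 1)) (j j' : Fin (b + 1))
    (k k' : Fin (c + 1)) :
    ∃ x : ℝ, 0 ≤ x ∧ rawVertex a b c i j k * rawVertex c b a k' j' i' * cap c k k' * cap b j j' *
      cap a i i' = (-1) ^ ((a + b + c) / 2) * (x : ℂ) := by
  by_cases hi : (i : ℕ) + i' = a
  swap
  · exact ⟨0, le_rfl, by simp [cap, hi]⟩
  by_cases hj : (j : ℕ) + j' = b
  swap
  · exact ⟨0, le_rfl, by simp [cap, hj]⟩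
  by_cases hk : (k : ℕ) + k' = c
  swap
  · exact ⟨0, le_rfl, by simp [cap, hk]⟩
  by_cases h : rawVertex a b c i j k = 0
  · exact ⟨0, le_rfl, by simp [h]⟩
  have hsum := two_mul_add_eq_of_rawVertex_ne_zero h
  obtain ⟨x, hx⟩ := Complex.conj_eq_iff_real.1 (conj_rawVertex a b c i j k)
  refine ⟨x ^ 2 / (c.choose k * b.choose j * a.choose i), by positivity, ?_⟩
  rw [rawVertex_reverse a b c i i' j j' k k' hi hj hk, hx, cap, cap, cap, if_pos hi, if_pos hj,
    if_pos hk, show (a + b + c) / 2 = (c - k) + (b - j) + (a - i) by omega]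
  push_cast
  ring

lemma theta_eq_neg_one_pow_mul (a b c : ℕ) :
    ∃ x : ℝ, 0 ≤ x ∧ theta a b c = (-1) ^ ((a + b + c) / 2) * (x : ℂ) := by
  choose f hf₀ hf using theta_term_nonneg a b c
  refine ⟨∑ i, ∑ i', ∑ j, ∑ j', ∑ k, ∑ k', f i i' j j' k k', ?_, ?_⟩
  · exact Finset.sum_nonneg fun i _ => Finset.sum_nonneg fun i' _ => Finset.sum_nonneg fun j _ =>
      Finset.sum_nonneg fun j' _ => Finset.sum_nonneg fun k _ => Finset.sum_nonneg fun k' _ =>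
        hf₀ i i' j j' k k'
  · simp only [theta, hf, Complex.ofReal_sum, Finset.mul_sum]

/-- The network `doubleY` with vertices that are not normalized. -/
noncomputable def rawDoubleY (a b c d k : ℕ)
    (i₁ : Fin (a + 1)) (i₂ : Fin (b + 1)) (i₃ : Fin (c + 1)) (i₄ : Fin (d + 1)) : ℂ :=
  ∑ m : Fin (k + 1), ∑ m' : Fin (k + 1),
    rawVertex a b k i₁ i₂ m * cap k m m' * rawVertex k c d m' i₃ i₄

lemma conj_rawDoubleY (a b c d k : ℕ)
    (i₁ : Fin (a + 1)) (i₂ : Fin (b + 1)) (i₃ : Fin (c + 1)) (i₄ : Fin (d + 1)) :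
    conj (rawDoubleY a b c d k i₁ i₂ i₃ i₄) = rawDoubleY a b c d k i₁ i₂ i₃ i₄ := by
  simp only [rawDoubleY, map_sum, map_mul, conj_rawVertex, conj_cap]

lemma doubleY_eq_div (r : ℕ → ℕ → ℕ → ℂ) (a b c d k : ℕ)
    (i₁ : Fin (a + 1)) (i₂ : Fin (b + 1)) (i₃ : Fin (c + 1)) (i₄ : Fin (d + 1)) :
    doubleY r a b c d k i₁ i₂ i₃ i₄ =
      rawDoubleY a b c d k i₁ i₂ i₃ i₄ / (r a b k * r k c d) := by
  simp only [doubleY, rawDoubleY, vertex, Finset.sum_div]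
  refine Finset.sum_congr rfl fun m _ => Finset.sum_congr rfl fun m' _ => ?_
  simp only [div_eq_mul_inv, mul_inv]
  ring

/-- The evaluation of the closed `SU(2)` network that is obtained from the pentagon network by
putting the four-legged tensor `Y v` at every vertex `v`. -/
noncomputable def pentagon (p q : Fin 5 → ℕ)
    (Y : ∀ v : Fin 5, Fin (q (v - 2) + 1) → Fin (p (v - 1) + 1) → Fin (p v + 1) →
      Fin (q v + 1) → ℂ) : ℂ :=
  ∑ s : (∀ v, Fin (p v + 1)), ∑ s' : (∀ v, Fin (p v + 1)),
    ∑ t : (∀ v, Fin (q v + 1)), ∑ t' : (∀ v, Fin (q v + 1)),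
      (∏ v : Fin 5, Y v (t' (v - 2)) (s' (v - 1)) (s v) (t v)) *
      ∏ v : Fin 5, (cap (p v) (s v) (s' v) * cap (q v) (t v) (t' v))

lemma sum_pi_prod {ι : Type*} [Fintype ι] [DecidableEq ι] {A : ι → Type*} [∀ i, Fintype (A i)]
    {M : Type*} [AddCommMonoid M] (f : (∀ i, A i × A i) → M) :
    ∑ s, f s = ∑ s₁ : (∀ i, A i), ∑ s₂ : (∀ i, A i), f (fun i => (s₁ i, s₂ i)) := by
  refine Eq.trans ?_ (Fintype.sum_prod_type' fun (s₁ s₂ : ∀ i, A i) => f fun i => (s₁ i, s₂ i))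
  refine Fintype.sum_equiv
    ⟨fun s => (fun i => (s i).1, fun i => (s i).2), fun s i => (s.1 i, s.2 i),
      fun _ => rfl, fun _ => rfl⟩ _ _ fun _ => rfl

lemma modifiedTenJ_eq_sum (r : ℕ → ℕ → ℕ → ℂ) (p q : Fin 5 → ℕ) :
    modifiedTenJ r p q =
      ∑ k ∈ Fintype.piFinset fun v => (Finset.range (q (v - 2) + p (v - 1) + 1)).filter
          (fun k => Admissible (q (v - 2)) (p (v - 1)) k ∧ Admissible (p v) (q v) k),
        (∏ v, ((k v : ℂ) + 1)) *
          pentagon p q (fun v => doubleY r (q (v - 2)) (p (v - 1)) (p v) (q v) (k v)) ^ 2 := by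
  unfold pentagon
  simp only [sq, Finset.sum_mul_sum]
  simp only [Finset.mul_sum]
  symm
  unfold modifiedTenJ
  -- One pass for each index family `s`, `s'`, `t`, `t'`: its two components are matched with the
  -- two copies of the network, and the sum over `k` moves inward.
  iterate 4
    rw [sum_pi_prod, Finset.sum_comm]
    refine Finset.sum_congr rfl fun _ _ => ?_
    rw [Finset.sum_comm]
    refine Finset.sum_congr rfl fun _ _ => ?_
  simp only [modifiedBC, simpleCap, Finset.prod_univ_sum, Finset.sum_mul]
  refine Finset.sum_congr rfl fun k _ => ?_
  simp only [Finset.prod_mul_distrib]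
  ring

lemma pentagon_doubleY_eq_div (r : ℕ → ℕ → ℕ → ℂ) (p q k : Fin 5 → ℕ) :
    pentagon p q (fun v => doubleY r (q (v - 2)) (p (v - 1)) (p v) (q v) (k v)) =
      pentagon p q (fun v => rawDoubleY (q (v - 2)) (p (v - 1)) (p v) (q v) (k v)) /
        ∏ v, (r (q (v - 2)) (p (v - 1)) (k v) * r (k v) (p v) (q v)) := by
  simp only [pentagon, doubleY_eq_div, Finset.prod_div_distrib, Finset.sum_div]
  refine Finset.sum_congr rfl fun s _ => Finset.sum_congr rfl fun s' _ =>
    Finset.sum_congr rfl fun t _ => Finset.sum_congr rfl fun t' _ => ?_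
  rw [div_mul_eq_mul_div]

lemma conj_pentagon_rawDoubleY (p q k : Fin 5 → ℕ) :
    conj (pentagon p q fun v => rawDoubleY (q (v - 2)) (p (v - 1)) (p v) (q v) (k v)) =
      pentagon p q fun v => rawDoubleY (q (v - 2)) (p (v - 1)) (p v) (q v) (k v) := by
  simp only [pentagon, map_sum, map_mul, map_prod, conj_rawDoubleY, conj_cap]

/-- The range of summation tests `c, d, k`, whereas the vertex and its root use the order `k, c, d`.
-/
lemma Admissible.rotate {a b c : ℕ} (h : Admissible a b c) : Admissible c a b := by
  obtain ⟨h₁, h₂, h₃, h₄⟩ := h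
  refine ⟨by omega, by omega, by omega, ?_⟩
  rwa [show c + a + b = a + b + c by ring]

/-- The five incoming vertices together contain every edge once, and so do the five outgoing ones.
Hence the two halves of the sum are equal. -/
lemma even_sum_pentagon {p q k : Fin 5 → ℕ}
    (h : ∀ v, Admissible (q (v - 2)) (p (v - 1)) (k v) ∧ Admissible (k v) (p v) (q v)) :
    Even (∑ v, ((q (v - 2) + p (v - 1) + k v) / 2 + (k v + p v + q v) / 2)) := by
  have h₁ (v) : 2 * ((q (v - 2) + p (v - 1) + k v) / 2) = q (v - 2) + p (v - 1) + k v :=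
    Nat.two_mul_div_two_of_even (h v).1.2.2.2
  have h₂ (v) : 2 * ((k v + p v + q v) / 2) = k v + p v + q v :=
    Nat.two_mul_div_two_of_even (h v).2.2.2.2
  have hq : ∑ v, q (v - 2) = ∑ v, q v := Equiv.sum_comp (Equiv.subRight 2) q
  have hp : ∑ v, p (v - 1) = ∑ v, p v := Equiv.sum_comp (Equiv.subRight 1) p
  have e₁ : 2 * ∑ v, (q (v - 2) + p (v - 1) + k v) / 2 = ∑ v, q v + ∑ v, p v + ∑ v, k v := by
    rw [Finset.mul_sum, Finset.sum_congr rfl fun v _ => h₁ v, Finset.sum_add_distrib,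
      Finset.sum_add_distrib, hq, hp]
  have e₂ : 2 * ∑ v, (k v + p v + q v) / 2 = ∑ v, k v + ∑ v, p v + ∑ v, q v := by
    rw [Finset.mul_sum, Finset.sum_congr rfl fun v _ => h₂ v, Finset.sum_add_distrib,
      Finset.sum_add_distrib]
  rw [Finset.sum_add_distrib, Nat.even_iff]
  omega

lemma pentagon_doubleY_sq_nonneg {r : ℕ → ℕ → ℕ → ℂ} (hr : IsThetaRoot r) {p q k : Fin 5 → ℕ}
    (h : ∀ v, Admissible (q (v - 2)) (p (v - 1)) (k v) ∧ Admissible (k v) (p v) (q v)) :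
    ∃ x : ℝ, 0 ≤ x ∧
      pentagon p q (fun v => doubleY r (q (v - 2)) (p (v - 1)) (p v) (q v) (k v)) ^ 2 = x := by
  choose θ hθ₀ hθ using theta_eq_neg_one_pow_mul
  obtain ⟨x, hx⟩ := Complex.conj_eq_iff_real.1 (conj_pentagon_rawDoubleY p q k)
  -- Nonvanishing of theta is not needed: if a factor is 0, both quotients are 0 by convention.
  refine ⟨x ^ 2 / ∏ v, (θ (q (v - 2)) (p (v - 1)) (k v) * θ (k v) (p v) (q v)),
    div_nonneg (sq_nonneg x) (Finset.prod_nonneg fun v _ => mul_nonneg (hθ₀ ..) (hθ₀ ..)), ?_⟩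
  have hroots : (∏ v, (r (q (v - 2)) (p (v - 1)) (k v) * r (k v) (p v) (q v))) ^ 2 =
      ∏ v, ((θ (q (v - 2)) (p (v - 1)) (k v) : ℂ) * θ (k v) (p v) (q v)) := by
    calc (∏ v, (r (q (v - 2)) (p (v - 1)) (k v) * r (k v) (p v) (q v))) ^ 2
        = ∏ v, ((-1) ^ ((q (v - 2) + p (v - 1) + k v) / 2 + (k v + p v + q v) / 2) *
            ((θ (q (v - 2)) (p (v - 1)) (k v) : ℂ) * θ (k v) (p v) (q v))) := by
          rw [← Finset.prod_pow]
          refine Finset.prod_congr rfl fun v _ => ?_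
          rw [mul_pow, hr _ _ _ (h v).1, hr _ _ _ (h v).2, hθ, hθ, pow_add]
          ring
      _ = _ := by
          rw [Finset.prod_mul_distrib, Finset.prod_pow_eq_pow_sum, (even_sum_pentagon h).neg_one_pow,
            one_mul]
  rw [pentagon_doubleY_eq_div, div_pow, hroots, hx]
  push_cast
  rfl

end SpinNetwork

theorem lemma3 (r : ℕ → ℕ → ℕ → ℂ) (hr : SpinNetwork.IsThetaRoot r) (p q : Fin 5 → ℕ) :
    (SpinNetwork.modifiedTenJ r p q).im = 0 ∧ 0 ≤ (SpinNetwork.modifiedTenJ r p q).re := by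
  rw [SpinNetwork.modifiedTenJ_eq_sum, Complex.im_sum, Complex.re_sum]
  have h : ∀ k ∈ Fintype.piFinset fun v => (Finset.range (q (v - 2) + p (v - 1) + 1)).filter
      (fun k => SpinNetwork.Admissible (q (v - 2)) (p (v - 1)) k ∧
        SpinNetwork.Admissible (p v) (q v) k),
      ∃ x : ℝ, 0 ≤ x ∧ (∏ v, ((k v : ℂ) + 1)) * SpinNetwork.pentagon p q
        (fun v => SpinNetwork.doubleY r (q (v - 2)) (p (v - 1)) (p v) (q v) (k v)) ^ 2 = x := by
    intro k hk
    simp only [Fintype.mem_piFinset, Finset.mem_filter] at hk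
    obtain ⟨x, hx₀, hx⟩ := SpinNetwork.pentagon_doubleY_sq_nonneg hr
      fun v => ⟨(hk v).2.1, (hk v).2.2.rotate⟩
    refine ⟨(∏ v, ((k v : ℝ) + 1)) * x, by positivity, ?_⟩
    rw [hx]
    push_cast
    rfl
  constructor
  · refine Finset.sum_eq_zero fun k hk => ?_
    obtain ⟨x, -, hx⟩ := h k hk
    rw [hx, Complex.ofReal_im]
  · refine Finset.sum_nonneg fun k hk => ?_
    obtain ⟨x, hx₀, hx⟩ := h k hk
    rwa [hx, Complex.ofReal_re]
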